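/- Let $n\ge 3$ be an integer. A directed graph may have parallel edges (it need not be simple); it is $3$-regular if every vertex is incident to exactly three edges, i.e. its indegree and outdegree add up to $3$. A source (sink) is a vertex of indegree (outdegree) $0$. A source-to-sink path is a directed path from the source to the sink, and paths that use different parallel edges are counted as different. Let $D$ be a (not necessarily simple) $3$-regular acyclic directed graph on $2n$ vertices with a unique source and a unique sink. Then $D$ has at most $9\cdot 2^{n-3}$ source-to-sink paths. Moreover, this bound is tight: for every $n\ge 3$ there is such a directed graph on $2n$ vertices with exactly $9\cdot 2^{n-3}$ source-to-sink paths. -/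

import Mathlib

/-! A directed multigraph is a Mathlib `Quiver`: for vertices `a`, `b` the type `a ⟶ b` is the type of
(distinguishable, possibly parallel) edges directed from `a` to `b`.  `Quiver.Path a b` is the type of
directed walks, given by their sequences of edges, so routes through different parallel edges are
different; in an acyclic quiver no vertex is repeated along one, so these are the directed paths. -/

universe v u

namespace Quiver

/-- The outdegree of `a`: the number of edges starting at `a`, possibly infinite. -/
noncomputable def outdegree {V : Type u} [Quiver.{v} V] (a : V) : ℕ∞ :=
  ENat.card (Star a)

/-- The indegree of `a`: the number of edges ending at `a`, possibly infinite. -/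
noncomputable def indegree {V : Type u} [Quiver.{v} V] (a : V) : ℕ∞ :=
  ENat.card (Costar a)

/-- Every vertex is incident to exactly `d` edges, irrespective of their direction. -/
def IsRegularOfDegree (V : Type u) [Quiver.{v} V] (d : ℕ) : Prop :=
  ∀ a : V, outdegree a + indegree a = d

/-- There is no directed cycle: every closed directed walk has length `0`. -/
def IsAcyclic (V : Type u) [Quiver.{v} V] : Prop :=
  ∀ (a : V) (p : Path a a), p.length = 0

/-- `s` is the unique source, i.e. the unique vertex at which no edge ends. -/
def IsUniqueSource {V : Type u} [Quiver.{v} V] (s : V) : Prop :=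
  ∀ a : V, indegree a = 0 ↔ a = s

/-- `t` is the unique sink, i.e. the unique vertex at which no edge starts. -/
def IsUniqueSink {V : Type u} [Quiver.{v} V] (t : V) : Prop :=
  ∀ a : V, outdegree a = 0 ↔ a = t

/-- The quiver is finite with `m` vertices, `3`-regular and acyclic, and it has the unique source `s`
and the unique sink `t`. -/
structure IsCubicAcyclic (V : Type u) [Quiver.{v} V] (m : ℕ) (s t : V) : Prop where
  finite : Finite V
  card_vertices : Nat.card V = m
  regular : IsRegularOfDegree V 3
  acyclic : IsAcyclic V
  source : IsUniqueSource s
  sink : IsUniqueSink t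

end Quiver

/-! Sweep a cut from the source to the sink in topological order, giving each cut edge the number of
paths from `s` to its tail. The cut starts as three ones. Passing a vertex either duplicates a
weight (indegree 1) or adds two weights (indegree 2), and the last three weights sum to the number
of paths (`splitMerge_cut`). Counting edges gives `n - 1` splits. A split at most doubles the sum,
and less if the cut has other edges: with `z` a lower bound for the weights, sum minus `z` at most
doubles. Hence a cut that never shrinks to one edge yields at most `1 + 2 ^ n`. A one-edge cut
doubles fully at its first split but then has to open up again, which costs a factor `3 / 4`
(`total_le`). Both cases give `9 * 2 ^ (n - 3)`. -/

namespace Quiver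

/-! ### The split-merge process on multisets of weights. -/

/-- `SplitMerge S b m T`: starting from the multiset `S`, some sequence of `b` duplications of an
element and `m` replacements of two elements by their sum ends in a three-element multiset
with sum `T`. -/
inductive SplitMerge : Multiset ℕ → ℕ → ℕ → ℕ → Prop
  | done (S : Multiset ℕ) (h : S.card = 3) : SplitMerge S 0 0 S.sum
  | split (x : ℕ) (S : Multiset ℕ) (b m T : ℕ) (h : SplitMerge (x ::ₘ x ::ₘ S) b m T) :
      SplitMerge (x ::ₘ S) (b + 1) m T
  | merge (x y : ℕ) (S : Multiset ℕ) (b m T : ℕ) (h : SplitMerge ((x + y) ::ₘ S) b m T) :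
      SplitMerge (x ::ₘ y ::ₘ S) b (m + 1) T

namespace SplitMerge

theorem card_add {S : Multiset ℕ} {b m T : ℕ} (h : SplitMerge S b m T) :
    S.card + b = m + 3 := by
  induction h with
  | done S h => omega
  | split x S b m T h ih => simp only [Multiset.card_cons] at ih ⊢; omega
  | merge x y S b m T h ih => simp only [Multiset.card_cons] at ih ⊢; omega

/-- If the multiset is a singleton, the total is at most three quarters of `2 ^ b` times its sum;
otherwise the total may also be reached by setting aside a smallest element. -/
theorem total_le {S : Multiset ℕ} {b m T : ℕ} (h : SplitMerge S b m T) :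
    (S.card = 1 → 4 * T ≤ 3 * S.sum * 2 ^ b) ∧
    (2 ≤ S.card → ∀ z, (∀ x ∈ S, z ≤ x) →
      (2 ≤ b ∧ 4 * T ≤ 3 * S.sum * 2 ^ b) ∨ T + 2 ^ b * z ≤ z + 2 ^ b * S.sum) := by
  induction h with
  | done S h => exact ⟨by omega, fun _ z _ => Or.inr (by simp [add_comm])⟩
  | split x S b m T h ih =>
    have hc := h.card_add
    simp only [Multiset.card_cons, Multiset.sum_cons] at ih hc ⊢
    refine ⟨fun h1 => ?_, fun h2 z hz => ?_⟩
    · obtain rfl : S = 0 := Multiset.card_eq_zero.1 (by omega)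
      -- Two equal weights still need another split to become three.
      have hb : 2 ^ 1 ≤ 2 ^ b := Nat.pow_le_pow_right (by norm_num) (by simp at hc; omega)
      rcases ih.2 (by omega) x (by simp) with h3 | h3
      · simp only [Multiset.sum_zero, pow_succ] at h3 ⊢
        linarith [h3.2]
      · simp only [Multiset.sum_zero, pow_succ] at h3 ⊢
        nlinarith [Nat.mul_le_mul_left x hb]
    · have hxz : x + z ≤ x + S.sum := by
        obtain ⟨y, hy⟩ := Multiset.card_pos_iff_exists_mem.1 (show 0 < S.card by omega)
        have := hz y (Multiset.mem_cons_of_mem hy)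
        have := Multiset.le_sum_of_mem hy
        omega
      rcases ih.2 (by omega) z (by simpa using hz) with h3 | h3
      · left
        refine ⟨by omega, h3.2.trans ?_⟩
        rw [pow_succ]
        nlinarith [Nat.zero_le (S.sum * 2 ^ b)]
      · right
        rw [pow_succ]
        have hzx := hz x (Multiset.mem_cons_self x S)
        nlinarith [Nat.mul_le_mul_left (2 ^ b) hxz]
  | merge x y S b m T h ih =>
    have hc := h.card_add
    simp only [Multiset.card_cons, Multiset.sum_cons] at ih hc ⊢
    refine ⟨by omega, fun h2 z hz => ?_⟩
    by_cases h3 : S.card = 0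
    · left
      refine ⟨by omega, ?_⟩
      have := ih.1 (by omega)
      rwa [add_assoc] at this
    · have := ih.2 (by omega) z (by
        intro w hw
        rcases Multiset.mem_cons.1 hw with rfl | hw
        · exact (hz x (by simp)).trans (Nat.le_add_right _ _)
        · exact hz w (by simp [hw]))
      rwa [add_assoc] at this

theorem le_of_ones {b m T : ℕ} (h : SplitMerge (Multiset.replicate 3 1) b m T) (hb : 2 ≤ b) :
    T ≤ 9 * 2 ^ (b - 2) := by
  obtain ⟨k, rfl⟩ := Nat.exists_eq_add_of_le' hb
  have hk : 1 ≤ 2 ^ k := Nat.one_le_two_pow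
  -- With sum 3 and `z = 1` and `b = k + 2`, the bounds are `9 * 2 ^ k` and `1 + 8 * 2 ^ k`.
  rcases h.total_le.2 (by simp) 1 (by simp) with h1 | h1
  · have h1 := h1.2
    simp [pow_succ] at h1 ⊢
    omega
  · simp [pow_succ] at h1 ⊢
    omega

end SplitMerge

/-! ### From a directed multigraph to the split-merge process. -/

section Cut

variable {V : Type*} [Fintype V] [DecidableEq V] (A : V → V → ℕ) (N : V → ℕ)

/-- The multiset of weights `N a` over all edges `a ⟶ b` leaving `U`, where `A a b` is the number of
edges from `a` to `b`. -/
def cut (U : Finset V) : Multiset ℕ :=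
  ∑ a ∈ U, ∑ b ∈ Uᶜ, A a b • ({N a} : Multiset ℕ)

/-- Passing `v` trades the edges from `U` into `v` for those leaving `v`; the edges in `R` avoid
`v`. -/
theorem cut_insert {U : Finset V} {v : V} (hv : v ∉ U) :
    ∃ R, cut A N U = ∑ a ∈ U, A a v • ({N a} : Multiset ℕ) + R ∧
      cut A N (insert v U) = (∑ b ∈ (insert v U)ᶜ, A v b) • ({N v} : Multiset ℕ) + R := by
  have hU : Uᶜ = insert v (insert v U)ᶜ := by
    ext x; by_cases h : x = v <;> simp [h, hv]
  refine ⟨∑ a ∈ U, ∑ b ∈ (insert v U)ᶜ, A a b • {N a}, ?_, ?_⟩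
  · rw [cut, hU, ← Finset.sum_add_distrib]
    exact Finset.sum_congr rfl fun a _ => Finset.sum_insert (by simp)
  · rw [cut, Finset.sum_insert hv, Finset.sum_smul]

variable {A N}

/-- Sweeping a cut through a cubic acyclic directed multigraph in topological order. -/
theorem splitMerge_cut {s t : V} (wf : WellFounded fun a b => A a b ≠ 0)
    (hreg : ∀ v, ∑ b, A v b + ∑ a, A a v = 3) (hs : ∀ v, ∑ a, A a v = 0 ↔ v = s)
    (ht : ∀ v, ∑ b, A v b = 0 ↔ v = t) (hN : ∀ v, v ≠ s → N v = ∑ a, A a v * N a)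
    (k : ℕ) (U : Finset V) (hk : Uᶜ.card = k + 1) (hsU : s ∈ U) (htU : t ∉ U)
    (hU : ∀ a b, b ∈ U → A a b ≠ 0 → a ∈ U) :
    ∃ b m, b + m = k ∧ SplitMerge (cut A N U) b m (N t) := by
  have htA : ∀ b, A t b = 0 := fun b => by
    simpa using (Finset.sum_eq_zero_iff.1 ((ht t).2 rfl)) b (Finset.mem_univ b)
  have hIn : ∀ (U : Finset V) (v : V), (∀ a, a ∉ U → A a v = 0) → ∀ f : V → ℕ,
      ∑ a ∈ U, A a v * f a = ∑ a, A a v * f a := fun U v hv f =>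
    Finset.sum_subset (Finset.subset_univ _) fun a _ ha => by simp [hv a ha]
  have hIn1 : ∀ (U : Finset V) (v : V), (∀ a, a ∉ U → A a v = 0) →
      ∑ a ∈ U, A a v = ∑ a, A a v := fun U v hv => by simpa using hIn U v hv 1
  induction k generalizing U with
  | zero =>
    obtain ⟨t', ht'⟩ := Finset.card_eq_one.1 hk
    obtain rfl : t = t' := by simpa [ht'] using Finset.mem_compl.2 htU
    have hv : ∀ a, a ∉ U → A a t = 0 := fun a ha => by
      have : a = t := by simpa [ht'] using Finset.mem_compl.2 ha
      rw [this, htA]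
    have hcut : cut A N U = ∑ a ∈ U, A a t • ({N a} : Multiset ℕ) := by simp [cut, ht']
    have hsum : (cut A N U).sum = N t := by
      rw [hN t (by rintro rfl; exact htU hsU), ← hIn U t hv, hcut, Multiset.sum_sum]
      simp [Multiset.sum_nsmul]
    refine ⟨0, 0, rfl, hsum ▸ SplitMerge.done _ ?_⟩
    have := hreg t
    rw [(ht t).2 rfl, ← hIn1 U t hv] at this
    simpa [hcut] using this
  | succ k ih =>
    -- A minimal unswept vertex other than `t` has all its in-edges from `U`, since `t` has no
    -- out-edges.
    obtain ⟨v, ⟨hvU, hvt⟩, hmin⟩ := wf.has_min {v | v ∉ U ∧ v ≠ t} (by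
      obtain ⟨v, hv, hvt⟩ := Finset.exists_mem_ne (by omega : 1 < Uᶜ.card) t
      exact ⟨v, by simpa using hv, hvt⟩)
    have hv : ∀ a, a ∉ U → A a v = 0 := fun a ha => by
      by_contra h
      exact hmin a ⟨ha, by rintro rfl; exact h (htA v)⟩ h
    have hvs : v ≠ s := by rintro rfl; exact hvU hsU
    have hU' : ∀ a b, b ∈ insert v U → A a b ≠ 0 → a ∈ insert v U := by
      intro a b hb hab
      rcases Finset.mem_insert.1 hb with rfl | hb
      · by_contra h
        exact hab (hv a fun h' => h (Finset.mem_insert_of_mem h'))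
      · exact Finset.mem_insert_of_mem (hU a b hb hab)
    have hout : ∑ b ∈ (insert v U)ᶜ, A v b = ∑ b, A v b := by
      refine Finset.sum_subset (Finset.subset_univ _) fun b _ hb => ?_
      have hb : b ∈ insert v U := by rwa [Finset.mem_compl, not_not] at hb
      rcases Finset.mem_insert.1 hb with rfl | hb
      · exact hv b hvU
      · by_contra h
        exact hvU (hU v b hb h)
    obtain ⟨b, m, hbm, hrun⟩ := ih (insert v U)
      (by rw [Finset.card_compl] at hk ⊢; rw [Finset.card_insert_of_notMem hvU]; omega)
      (by simp [hsU]) (by simp [htU, hvt.symm]) hU'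
    obtain ⟨R, hR, hR'⟩ := cut_insert A N hvU
    rw [hout] at hR'
    set I := ∑ a ∈ U, A a v • ({N a} : Multiset ℕ) with hI
    have hIc : I.card = ∑ a, A a v := by
      rw [← hIn1 U v hv]; simp [I]
    have hIs : I.sum = N v := by
      rw [hN v hvs, ← hIn U v hv, hI, Multiset.sum_sum]; simp [Multiset.sum_nsmul]
    have h3 := hreg v
    have h1 := (hs v).not.2 hvs
    have h2 := (ht v).not.2 hvt
    rcases (by omega : ∑ a, A a v = 1 ∧ ∑ b, A v b = 2 ∨ ∑ a, A a v = 2 ∧ ∑ b, A v b = 1) with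
      ⟨hi, ho⟩ | ⟨hi, ho⟩
    · obtain ⟨x, hx⟩ := Multiset.card_eq_one.1 (hIc.trans hi)
      rw [hx, Multiset.sum_singleton] at hIs
      rw [hx, Multiset.singleton_add] at hR
      rw [ho, ← hIs, two_smul, add_assoc, Multiset.singleton_add, Multiset.singleton_add] at hR'
      exact ⟨b + 1, m, by omega, hR ▸ .split x R b m _ (hR' ▸ hrun)⟩
    · obtain ⟨x, y, hx⟩ := Multiset.card_eq_two.1 (hIc.trans hi)
      rw [hx, Multiset.sum_pair] at hIs
      rw [hx, Multiset.insert_eq_cons, Multiset.cons_add, Multiset.singleton_add] at hR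
      rw [ho, ← hIs, one_smul, Multiset.singleton_add] at hR'
      exact ⟨b, m + 1, by omega, hR ▸ .merge x y R b m _ (hR' ▸ hrun)⟩

theorem exists_splitMerge {s t : V} (wf : WellFounded fun a b => A a b ≠ 0)
    (hreg : ∀ v, ∑ b, A v b + ∑ a, A a v = 3) (hs : ∀ v, ∑ a, A a v = 0 ↔ v = s)
    (ht : ∀ v, ∑ b, A v b = 0 ↔ v = t) (hNs : N s = 1)
    (hN : ∀ v, v ≠ s → N v = ∑ a, A a v * N a) :
    ∃ b m, b + m + 2 = Fintype.card V ∧ SplitMerge (Multiset.replicate 3 1) b m (N t) := by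
  have hst : s ≠ t := by
    rintro rfl
    have := hreg s
    rw [(hs s).2 rfl, (ht s).2 rfl] at this
    omega
  have hsA : ∀ a, A a s = 0 := fun a => by
    simpa using (Finset.sum_eq_zero_iff.1 ((hs s).2 rfl)) a (Finset.mem_univ a)
  have h2 : 2 ≤ Fintype.card V := by
    simpa [hst] using Finset.card_le_univ ({s, t} : Finset V)
  obtain ⟨b, m, hbm, h⟩ := splitMerge_cut wf hreg hs ht hN (Fintype.card V - 2) {s}
    (by rw [Finset.card_compl, Finset.card_singleton]; omega) (by simp) (by simp [hst.symm])
    (by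
      intro a b hb hab
      rw [Finset.mem_singleton.1 hb, hsA] at hab
      exact absurd rfl hab)
  have hc : cut A N {s} = Multiset.replicate 3 1 := by
    have h3 := hreg s
    rw [(hs s).2 rfl, ← Finset.sum_add_sum_compl {s}] at h3
    simp only [Finset.sum_singleton, hsA, zero_add, add_zero] at h3
    rw [cut, Finset.sum_singleton, ← Finset.sum_smul, h3, hNs, Multiset.nsmul_singleton]
  exact ⟨b, m, by omega, hc ▸ h⟩

end Cut

/-! ### Degrees and path counts in quivers. -/

section Paths

variable {V : Type u} [Quiver.{v} V]

theorem outdegree_eq_sum [Fintype V] [∀ a b : V, Finite (a ⟶ b)] (a : V) :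
    outdegree a = ((∑ b, Nat.card (a ⟶ b) : ℕ) : ℕ∞) := by
  rw [outdegree, ENat.card_eq_coe_natCard, Star, Nat.card_sigma]

theorem indegree_eq_sum [Fintype V] [∀ a b : V, Finite (a ⟶ b)] (b : V) :
    indegree b = ((∑ a, Nat.card (a ⟶ b) : ℕ) : ℕ∞) := by
  rw [indegree, ENat.card_eq_coe_natCard, Costar, Nat.card_sigma]

theorem IsRegularOfDegree.finite_hom {d : ℕ} (h : IsRegularOfDegree V d) (a b : V) :
    Finite (a ⟶ b) := by
  have hfin : Finite (Star a) := by
    rw [← ENat.card_lt_top]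
    exact (le_self_add.trans_eq (h a)).trans_lt (ENat.natCast_lt_top d)
  exact Finite.of_injective (fun e : a ⟶ b => (⟨b, e⟩ : Star a)) fun e e' h => by simpa using h

/-- Reachability by a path of positive length is a strict order on a finite type. -/
theorem IsAcyclic.wellFounded [Finite V] (h : IsAcyclic V) :
    WellFounded fun a b : V => Nonempty (a ⟶ b) := by
  let r : V → V → Prop := fun a b => ∃ p : Path a b, p.length ≠ 0
  have : IsTrans V r := ⟨fun a b c ⟨p, hp⟩ ⟨q, _⟩ => ⟨p.comp q, by rw [Path.length_comp]; omega⟩⟩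
  have : Std.Irrefl r := ⟨fun a ⟨p, hp⟩ => hp (h a p)⟩
  have hr : WellFounded r := Finite.wellFounded_of_trans_of_irrefl r
  exact Subrelation.wf (fun {a b} ⟨e⟩ => ⟨e.toPath, by simp [Hom.toPath]⟩) hr

/-- A path to a vertex other than its start is a path to some vertex followed by an edge. -/
def pathEquivSigma {s v : V} (h : v ≠ s) : Path s v ≃ Σ a, Path s a × (a ⟶ v) where
  toFun p := match v, p, h with
    | _, .nil, h => absurd rfl h
    | _, .cons (b := a) p e, _ => ⟨a, p, e⟩
  invFun x := x.2.1.cons x.2.2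
  left_inv p := by
    cases p with
    | nil => exact absurd rfl h
    | cons p e => rfl
  right_inv _ := rfl

theorem IsAcyclic.finite_path [Finite V] [∀ a b : V, Finite (a ⟶ b)] (h : IsAcyclic V) (s v : V) :
    Finite (Path s v) := by
  induction v using h.wellFounded.induction with
  | _ v ih =>
  by_cases hv : v = s
  · subst hv
    have : Subsingleton (Path v v) := ⟨fun p q => by
      rw [Path.eq_nil_of_length_zero p (h v p), Path.eq_nil_of_length_zero q (h v q)]⟩
    infer_instance
  · have : ∀ a, Finite (Path s a × (a ⟶ v)) := fun a => by
      by_cases ha : Nonempty (a ⟶ v)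
      · have := ih a ha
        infer_instance
      · rw [not_nonempty_iff] at ha
        infer_instance
    exact Finite.of_equiv _ (pathEquivSigma hv).symm

theorem IsAcyclic.card_path_self (h : IsAcyclic V) (s : V) : Nat.card (Path s s) = 1 := by
  have : Unique (Path s s) := ⟨⟨.nil⟩, fun p => Path.eq_nil_of_length_zero p (h s p)⟩
  exact Nat.card_unique

theorem IsAcyclic.card_path [Fintype V] [∀ a b : V, Finite (a ⟶ b)] (h : IsAcyclic V) {s v : V}
    (hv : v ≠ s) : Nat.card (Path s v) = ∑ a, Nat.card (a ⟶ v) * Nat.card (Path s a) := by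
  have := h.finite_path s
  rw [Nat.card_congr (pathEquivSigma hv), Nat.card_sigma]
  exact Finset.sum_congr rfl fun a _ => by rw [Nat.card_prod, mul_comm]

theorem IsCubicAcyclic.card_path_le {n : ℕ} (hn : 3 ≤ n) {s t : V}
    (h : IsCubicAcyclic V (2 * n) s t) :
    Finite (Path s t) ∧ Nat.card (Path s t) ≤ 9 * 2 ^ (n - 3) := by
  classical
  have := h.finite
  have := Fintype.ofFinite V
  have := h.regular.finite_hom
  refine ⟨h.acyclic.finite_path s t, ?_⟩
  obtain ⟨b, m, hbm, hrun⟩ := exists_splitMerge (A := fun a b : V => Nat.card (a ⟶ b))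
    (N := fun v => Nat.card (Path s v)) (s := s) (t := t)
    (Subrelation.wf (fun {a b} hab => (Nat.card_ne_zero.1 hab).1) h.acyclic.wellFounded)
    (fun v => by
      have := h.regular v
      rw [outdegree_eq_sum, indegree_eq_sum] at this
      exact_mod_cast this)
    (fun v => by
      have := h.source v
      rw [indegree_eq_sum] at this
      exact_mod_cast this)
    (fun v => by
      have := h.sink v
      rw [outdegree_eq_sum] at this
      exact_mod_cast this)
    (h.acyclic.card_path_self s) (fun v hv => h.acyclic.card_path hv)
  have h1 := hrun.card_add
  have h2 := h.card_vertices
  rw [Nat.card_eq_fintype_card] at h2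
  rw [Multiset.card_replicate] at h1
  -- The cut has three edges at both ends, so `b = m`, while `b + m = 2 * n - 2`.
  obtain rfl : b = n - 1 := by omega
  exact hrun.le_of_ones (by omega)

end Paths

/-! ### A graph attaining the bound. -/

section Extremal

/-- The number of edges from `a` to `a + 1` in the extremal quiver. -/
def extremalStep (m a : ℕ) : ℕ :=
  if a = 0 ∨ a = 2 * m + 4 ∨ (a % 2 = 1 ∧ a ≠ 1 ∧ a ≠ 2 * m + 3) then 2 else 1

/-- The number of edges from `a` to `b` in the extremal quiver with vertices `0, …, 2 * m + 5`. -/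
def extremalAdj (m a b : ℕ) : ℕ :=
  (if b = a + 1 then extremalStep m a else 0) + (if a = 0 then if b = 2 then 1 else 0 else 0) +
    (if a = 2 * m + 3 then if b = 2 * m + 5 then 1 else 0 else 0)

/-- The number of paths from `0` to `a` in the extremal quiver. -/
def extremalCount (m a : ℕ) : ℕ :=
  if a = 0 then 1 else if a = 1 then 2 else if a = 2 * m + 4 then 3 * 2 ^ m else
    if a = 2 * m + 5 then 9 * 2 ^ m else 3 * 2 ^ (a / 2 - 1)

/-- The extremal quiver with vertices `0, …, 2 * m + 5`. -/
abbrev extremalQuiver (m : ℕ) : Quiver.{0} (Fin (2 * m + 6)) :=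
  ⟨fun a b => Fin (extremalAdj m a b)⟩

theorem lt_of_extremalAdj_ne_zero {m a b : ℕ} (h : extremalAdj m a b ≠ 0) : a < b := by
  contrapose! h
  unfold extremalAdj
  split_ifs <;> omega

theorem sum_extremalAdj_right {m a : ℕ} :
    ∑ b : Fin (2 * m + 6), extremalAdj m a b =
      (if a + 1 < 2 * m + 6 then extremalStep m a else 0) + (if a = 0 then 1 else 0) +
        (if a = 2 * m + 3 then 1 else 0) := by
  rw [Fin.sum_univ_eq_sum_range (fun b => extremalAdj m a b)]
  simp only [extremalAdj, Finset.sum_add_distrib]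
  congr 1
  · congr 1
    · simp
    · split_ifs <;> simp
  · split_ifs <;> simp

theorem sum_extremalAdj_mul {m b : ℕ} (hb : b < 2 * m + 6) (f : ℕ → ℕ) :
    ∑ a : Fin (2 * m + 6), extremalAdj m a b * f a =
      (if b = 0 then 0 else extremalStep m (b - 1) * f (b - 1)) + (if b = 2 then f 0 else 0) +
        (if b = 2 * m + 5 then f (2 * m + 3) else 0) := by
  rw [Fin.sum_univ_eq_sum_range (fun a => extremalAdj m a b * f a)]
  simp only [extremalAdj, add_mul, Finset.sum_add_distrib]
  congr 1
  · congr 1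
    · cases b with
      | zero => simp
      | succ b =>
        have h : b < 2 * m + 6 := by omega
        simp [ite_mul, h]
    · simp [ite_mul]
  · simp [ite_mul]

theorem extremalCount_even {m k : ℕ} (hk : k ≤ m) : extremalCount m (2 * k + 2) = 3 * 2 ^ k := by
  have : (2 * k + 2) / 2 - 1 = k := by omega
  rw [extremalCount, if_neg (by omega), if_neg (by omega), if_neg (by omega), if_neg (by omega),
    this]

theorem extremalCount_odd {m k : ℕ} (hk : k ≤ m) : extremalCount m (2 * k + 3) = 3 * 2 ^ k := by
  have : (2 * k + 3) / 2 - 1 = k := by omega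
  rw [extremalCount, if_neg (by omega), if_neg (by omega), if_neg (by omega), if_neg (by omega),
    this]

theorem extremalCount_eq {m b : ℕ} (h0 : b ≠ 0) (hb : b < 2 * m + 6) :
    extremalCount m b = ∑ a : Fin (2 * m + 6), extremalAdj m a b * extremalCount m a := by
  rw [sum_extremalAdj_mul hb, if_neg h0]
  -- Apart from the two ends, an odd vertex is entered by a single edge and an even one by a double
  -- edge.
  have hcases : b = 1 ∨ b = 2 ∨ b = 2 * m + 4 ∨ b = 2 * m + 5 ∨
      (∃ k, k ≤ m ∧ b = 2 * k + 3) ∨ ∃ k, k < m ∧ b = 2 * (k + 1) + 2 := by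
    obtain ⟨k, hk | hk⟩ := Nat.even_or_odd' b
    · by_cases h : 2 ≤ k ∧ k < m + 2
      · exact .inr (.inr (.inr (.inr (.inr ⟨k - 2, by omega, by omega⟩))))
      · omega
    · by_cases h : 1 ≤ k ∧ k < m + 2
      · exact .inr (.inr (.inr (.inr (.inl ⟨k - 1, by omega, by omega⟩))))
      · omega
  rcases hcases with rfl | rfl | rfl | rfl | ⟨k, hk, rfl⟩ | ⟨k, hk, rfl⟩
  · simp [extremalCount, extremalStep]
  · simp [extremalCount, extremalStep]
  · have h2 : extremalStep m (2 * m + 3) = 1 := by simp [extremalStep]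
    have h3 : extremalCount m (2 * m + 4) = 3 * 2 ^ m := by simp [extremalCount]
    rw [if_neg (by omega), if_neg (by omega), show 2 * m + 4 - 1 = 2 * m + 3 by omega, h2,
      extremalCount_odd le_rfl, h3]
    ring
  · have h2 : extremalStep m (2 * m + 4) = 2 := by simp [extremalStep]
    have h3 : extremalCount m (2 * m + 4) = 3 * 2 ^ m := by simp [extremalCount]
    have h4 : extremalCount m (2 * m + 5) = 9 * 2 ^ m := by simp [extremalCount]
    rw [if_neg (by omega), if_pos rfl, show 2 * m + 5 - 1 = 2 * m + 4 by omega, h2,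
      extremalCount_odd le_rfl, h3, h4]
    ring
  · have h2 : extremalStep m (2 * k + 2) = 1 := if_neg (by omega)
    rw [if_neg (by omega), if_neg (by omega), show 2 * k + 3 - 1 = 2 * k + 2 by omega, h2,
      extremalCount_odd hk, extremalCount_even hk]
    ring
  · have h2 : extremalStep m (2 * k + 3) = 2 := if_pos (by omega)
    rw [if_neg (by omega), if_neg (by omega), show 2 * (k + 1) + 2 - 1 = 2 * k + 3 by omega, h2,
      extremalCount_odd hk.le, extremalCount_even hk, Nat.succ_eq_add_one, pow_succ]
    ring

/-- The three edges at the source merge at once into a one-edge cut of weight 3, `m` double edges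
each double it, and the mirror image of the start gives a last factor 3. -/
theorem exists_isCubicAcyclic_card_path (m : ℕ) :
    ∃ (V : Type) (_ : Quiver.{0} V) (s t : V), IsCubicAcyclic V (2 * m + 6) s t ∧
      Finite (Path s t) ∧ Nat.card (Path s t) = 9 * 2 ^ m := by
  let _ := extremalQuiver m
  have hcard : ∀ a b : Fin (2 * m + 6), Nat.card (a ⟶ b) = extremalAdj m a b := fun a b =>
    Nat.card_fin _
  have hfin : ∀ a b : Fin (2 * m + 6), Finite (a ⟶ b) := fun a b =>
    inferInstanceAs (Finite (Fin (extremalAdj m a b)))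
  have hlt : ∀ {a b : Fin (2 * m + 6)}, Nonempty (a ⟶ b) → a < b := fun {a b} hab =>
    lt_of_extremalAdj_ne_zero (hcard a b ▸ Nat.card_ne_zero.2 ⟨hab, hfin a b⟩)
  -- Every edge raises the label, which excludes closed walks of positive length.
  have hlen : ∀ {a b : Fin (2 * m + 6)} (p : Path a b), a.val + p.length ≤ b.val := by
    intro a b p
    induction p with
    | nil => simp
    | cons p e ih =>
      have := Fin.lt_def.1 (hlt ⟨e⟩)
      rw [Path.length_cons]
      omega
  have hac : IsAcyclic (Fin (2 * m + 6)) := fun a p => by have := hlen p; omega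
  have hin : ∀ b : Fin (2 * m + 6), ∑ a, Nat.card (a ⟶ b) =
      (if b.val = 0 then 0 else extremalStep m (b - 1)) + (if b.val = 2 then 1 else 0) +
        (if b.val = 2 * m + 5 then 1 else 0) := fun b => by
    simpa [hcard] using sum_extremalAdj_mul b.2 1
  have hout : ∀ a : Fin (2 * m + 6), ∑ b, Nat.card (a ⟶ b) = _ := fun a => by
    simp only [hcard]
    exact sum_extremalAdj_right
  have hN : ∀ v : Fin (2 * m + 6), Nat.card (Path (0 : Fin (2 * m + 6)) v) = extremalCount m v := by
    intro v
    induction v using hac.wellFounded.induction with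
    | _ v ih =>
    by_cases hv : v = 0
    · subst hv
      rw [hac.card_path_self]
      simp [extremalCount]
    · rw [hac.card_path hv, extremalCount_eq (fun h => hv (Fin.ext h)) v.2]
      refine Finset.sum_congr rfl fun a _ => ?_
      rw [hcard]
      by_cases ha : Nonempty (a ⟶ v)
      · rw [ih a ha]
      · rw [← hcard, not_nonempty_iff] at *
        simp
  refine ⟨Fin (2 * m + 6), extremalQuiver m, 0, Fin.last _, ⟨inferInstance, by simp, fun a => ?_, hac,
    fun a => ?_, fun a => ?_⟩, hac.finite_path _ _, ?_⟩
  · rw [outdegree_eq_sum, indegree_eq_sum, hin, hout, ← Nat.cast_add, Nat.cast_inj]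
    rcases a with ⟨a, ha⟩
    simp only [extremalStep]
    grind
  · rw [indegree_eq_sum, hin, Fin.ext_iff, Nat.cast_eq_zero, Fin.val_zero]
    simp only [extremalStep]
    grind
  · rw [outdegree_eq_sum, hout, Fin.ext_iff, Nat.cast_eq_zero, Fin.val_last]
    rcases a with ⟨a, ha⟩
    simp only [extremalStep]
    grind
  · rw [hN]
    simp [extremalCount]

end Extremal

end Quiver

theorem mainTheorem4 (n : ℕ) (hn : 3 ≤ n) :
    (∀ (V : Type u) [Quiver.{v} V] (s t : V), Quiver.IsCubicAcyclic V (2 * n) s t →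
      Finite (Quiver.Path s t) ∧ Nat.card (Quiver.Path s t) ≤ 9 * 2 ^ (n - 3)) ∧
    (∃ (V : Type) (_ : Quiver.{0} V) (s t : V), Quiver.IsCubicAcyclic V (2 * n) s t ∧
      Finite (Quiver.Path s t) ∧ Nat.card (Quiver.Path s t) = 9 * 2 ^ (n - 3)) := by
  refine ⟨fun V _ s t h => h.card_path_le hn, ?_⟩
  obtain ⟨m, rfl⟩ := Nat.exists_eq_add_of_le' hn
  exact Quiver.exists_isCubicAcyclic_card_path m
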